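/- Let $\mathcal H$ be a separable (finite- or infinite-dimensional) complex Hilbert space and let $\mathcal B(\mathcal H)$ be the algebra of bounded linear operators on $\mathcal H$. A density operator is an operator $\rho\in\mathcal B(\mathcal H)$ with $\rho\ge 0$ and $\operatorname{tr}(\rho)=1$; its von Neumann entropy is $S(\rho)=-\operatorname{tr}(\rho\log_2\rho)\in[0,\infty]$, with the convention $0\log_2 0=0$. A quantum channel on $\mathcal B(\mathcal H)$ is a linear map $\Phi:\mathcal B(\mathcal H)\to\mathcal B(\mathcal H)$ that is normal (continuous for the ultraweak topology), completely positive, and trace preserving (for every trace class operator $X$, $\Phi(X)$ is trace class and $\operatorname{tr}(\Phi(X))=\operatorname{tr}(X)$). **Theorem.** Let $\Phi$ be a quantum channel on $\mathcal B(\mathcal H)$. Then $S(\Phi(\rho))=S(\rho)$ for every density operator $\rho$ on $\mathcal H$ if and only if there exists an isometry $V\in\mathcal B(\mathcal H)$ (that is, $V^*V=I$) such that $\Phi(X)=VXV^*$ for all $X\in\mathcal B(\mathcal H)$. -/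

import Mathlib

open scoped InnerProductSpace ENNReal Topology CStarAlgebra

noncomputable section

namespace QuantumChannel

variable {H : Type*} [NormedAddCommGroup H] [InnerProductSpace ℂ H] [CompleteSpace H]

/-- The index set of a fixed orthonormal (Hilbert) basis of `H`. -/
def basisIndex (H : Type*) [NormedAddCommGroup H] [InnerProductSpace ℂ H] [CompleteSpace H] :
    Set H :=
  (exists_hilbertBasis ℂ H).choose

/-- A fixed orthonormal (Hilbert) basis of `H`, used to compute traces. The traces below do not
depend on this choice. -/
def basis (H : Type*) [NormedAddCommGroup H] [InnerProductSpace ℂ H] [CompleteSpace H] :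
    HilbertBasis (basisIndex H) ℂ H :=
  (exists_hilbertBasis ℂ H).choose_spec.choose

/-- The trace `∑ᵢ ⟪eᵢ, A eᵢ⟫ ∈ [0, ∞]` of a positive bounded operator `A`. (It is applied to
positive operators only.) -/
def posTrace (A : H →L[ℂ] H) : ℝ≥0∞ :=
  ∑' i, ENNReal.ofReal (⟪basis H i, A (basis H i)⟫_ℂ).re

/-- `T` is of trace class: `tr |T| < ∞`, where `|T| = (T* T)^(1/2)`. -/
def IsTraceClass (T : H →L[ℂ] H) : Prop :=
  posTrace (CFC.abs T) < ∞

/-- The trace `∑ᵢ ⟪eᵢ, T eᵢ⟫ ∈ ℂ` of a trace class operator `T`. -/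
def trace (T : H →L[ℂ] H) : ℂ :=
  ∑' i, ⟪basis H i, T (basis H i)⟫_ℂ

/-- `ρ` is a density operator (a quantum state): `ρ ≥ 0` and `tr ρ = 1`. -/
def IsDensityOperator (ρ : H →L[ℂ] H) : Prop :=
  0 ≤ ρ ∧ posTrace ρ = 1

/-- The von Neumann entropy `S(ρ) = - tr (ρ log₂ ρ) ∈ [0, ∞]` of a density operator `ρ`. The
operator `- ρ log₂ ρ` is given by the continuous functional calculus for the continuous function
`x ↦ - x log₂ x` (with `0 log₂ 0 = 0`), which is nonnegative on `[0, 1]`. -/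
def entropy (ρ : H →L[ℂ] H) : ℝ≥0∞ :=
  posTrace (cfc (fun x : ℝ => -(x * Real.logb 2 x)) ρ)

/-- The ultraweak (σ-weak) topology on `B(H)`: the coarsest topology for which all the functionals
`T ↦ ∑ₙ ⟪yₙ, T xₙ⟫`, with `∑ₙ ‖xₙ‖² < ∞` and `∑ₙ ‖yₙ‖² < ∞`, are continuous. -/
@[reducible] def ultraweakTopology (H : Type*) [NormedAddCommGroup H] [InnerProductSpace ℂ H] :
    TopologicalSpace (H →L[ℂ] H) :=
  ⨅ (x : ℕ → H) (y : ℕ → H) (_ : Summable fun n => ‖x n‖ ^ 2) (_ : Summable fun n => ‖y n‖ ^ 2),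
    TopologicalSpace.induced (fun T : H →L[ℂ] H => ∑' n, ⟪y n, T (x n)⟫_ℂ) inferInstance

/-- A map on `B(H)` is normal if it is continuous for the ultraweak topology. -/
def IsNormalMap (Φ : (H →L[ℂ] H) → (H →L[ℂ] H)) : Prop :=
  Continuous[ultraweakTopology H, ultraweakTopology H] Φ

/-- A map on `B(H)` is trace preserving if it maps trace class operators to trace class operators
of the same trace. -/
def IsTracePreserving (Φ : (H →L[ℂ] H) → (H →L[ℂ] H)) : Prop :=
  ∀ X : H →L[ℂ] H, IsTraceClass X → IsTraceClass (Φ X) ∧ trace (Φ X) = trace X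

/-- A completely positive linear map on `B(H)` is a quantum channel if it is normal and trace
preserving. -/
structure IsQuantumChannel (Φ : (H →L[ℂ] H) →CP (H →L[ℂ] H)) : Prop where
  normal : IsNormalMap (Φ : (H →L[ℂ] H) → (H →L[ℂ] H))
  tracePreserving : IsTracePreserving (Φ : (H →L[ℂ] H) → (H →L[ℂ] H))

end QuantumChannel

end

/-!
A channel of the form `X ↦ V X V*` with `V` an isometry commutes with the continuous functional
calculus of functions vanishing at `0`, and preserves traces, since `tr (B* B) = tr (B B*)`; hence
it preserves the entropy (`entropy_conj`).

Conversely, let `Φ` preserve the entropy. The states of entropy zero are exactly the idempotent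
ones (`IsDensityOperator.entropy_eq_zero_iff_isIdempotentElem`), that is, the pure states, so `Φ`
maps pure states to pure states, and no equal mixture of two orthogonal pure states to a pure
state. Complete positivity enters through a Gram representation: the kernel
`⟪h, Φ(|x⟩⟨y|) h'⟫` in the pairs `(x, h)`, `(y, h')` is, on finitely many pairs, the Gram matrix of
vectors in a Hilbert space (`exists_gram_rankOne`). If `x ⊥ y` are unit vectors and `|x⟩⟨x|`,
`|y⟩⟨y|` are mapped to `|f⟩⟨f|`, `|g⟩⟨g|`, this forces `Φ(|x⟩⟨y|) = c |f⟩⟨g|`. Here `c ≠ 0`, because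
otherwise the pure state of `(x + y) / √2` and the mixture of `|x⟩⟨x|` and `|y⟩⟨y|` would have the
same image; preservation of the trace of `|x⟩⟨y|` then gives `f ⊥ g`, and purity of the image of
`(x + y) / √2` gives `|c| = 1` (`IsQuantumChannel.map_rankOne_of_orthogonal`).

For an orthonormal basis `(bᵢ)` the images can be rephased so that `Φ(|bᵢ⟩⟨b₀|) = |fᵢ⟩⟨f₀|`. The
Gram vectors of `(bᵢ, fᵢ)`, `(bⱼ, fⱼ)`, `(b₀, f₀)` are then unit vectors with inner products `1` with
the last one, hence equal, and so `Φ(|bᵢ⟩⟨bⱼ|) = |fᵢ⟩⟨fⱼ|` for all `i`, `j`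
(`IsQuantumChannel.exists_orthonormal`). The isometry is `V bᵢ = fᵢ`; normality extends
`Φ(X) = V X V*` from matrix units to all `X`, as finite compressions of `X` converge
ultraweakly to `X` (`IsNormalMap.eq_conj`).
-/

open scoped InnerProductSpace ENNReal Topology CStarAlgebra

noncomputable section

namespace QuantumChannel

open ContinuousLinearMap InnerProductSpace Filter

/-! ### Traces of positive operators -/

section Trace

variable {H : Type*} [NormedAddCommGroup H] [InnerProductSpace ℂ H]

lemma re_inner_nonneg {A : H →L[ℂ] H} (hA : 0 ≤ A) (x : H) : 0 ≤ (⟪x, A x⟫_ℂ).re :=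
  ((nonneg_iff_isPositive A).mp hA).re_inner_nonneg_right x

lemma rankOne_self_nonneg (x : H) : 0 ≤ rankOne ℂ x x :=
  (nonneg_iff_isPositive _).mpr (isPositive_rankOne_self x)

variable [CompleteSpace H]

/-- Parseval's identity in `[0, ∞]`. -/
lemma ofReal_norm_sq_eq_tsum (x : H) :
    ENNReal.ofReal (‖x‖ ^ 2) = ∑' i, ENNReal.ofReal (‖⟪basis H i, x⟫_ℂ‖ ^ 2) := by
  have h := (basis H).hasSum_inner_mul_inner x x
  have h2 : HasSum (fun i => ‖⟪basis H i, x⟫_ℂ‖ ^ 2) (‖x‖ ^ 2) := by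
    have := Complex.hasSum_re h
    convert this using 1
    · funext i
      rw [← inner_conj_symm x, ← Complex.normSq_eq_conj_mul_self, Complex.ofReal_re,
        Complex.normSq_eq_norm_sq]
    · rw [inner_self_eq_norm_sq_to_K]
      norm_cast
  rw [← ENNReal.ofReal_tsum_of_nonneg (fun i => by positivity) h2.summable, h2.tsum_eq]

lemma posTrace_star_mul_self (B : H →L[ℂ] H) :
    posTrace (star B * B) = ∑' i, ENNReal.ofReal (‖B (basis H i)‖ ^ 2) := by
  unfold posTrace
  congr 1; funext i
  rw [mul_def, comp_apply, star_eq_adjoint, adjoint_inner_right, inner_self_eq_norm_sq_to_K]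
  norm_cast

/-- Both sides are `∑ᵢⱼ |⟪eⱼ, B eᵢ⟫|²`. -/
lemma posTrace_star_mul_self_comm (B : H →L[ℂ] H) :
    posTrace (star B * B) = posTrace (B * star B) := by
  have h := posTrace_star_mul_self (star B)
  rw [star_star] at h
  rw [h, posTrace_star_mul_self]
  simp_rw [ofReal_norm_sq_eq_tsum (B _), ofReal_norm_sq_eq_tsum (star B _)]
  rw [ENNReal.tsum_comm]
  congr 1; funext i; congr 1; funext j
  rw [star_eq_adjoint, adjoint_inner_right, norm_inner_symm]

/-- The Hilbert–Schmidt norm dominates the operator norm. -/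
lemma ofReal_norm_sq_apply_le (B : H →L[ℂ] H) (x : H) :
    ENNReal.ofReal (‖B x‖ ^ 2) ≤ posTrace (star B * B) * ENNReal.ofReal (‖x‖ ^ 2) := by
  have h := posTrace_star_mul_self (star B)
  rw [star_star] at h
  rw [posTrace_star_mul_self_comm, h, ofReal_norm_sq_eq_tsum, ← ENNReal.tsum_mul_right]
  refine ENNReal.tsum_le_tsum fun i => ?_
  rw [← ENNReal.ofReal_mul (by positivity)]
  refine ENNReal.ofReal_le_ofReal ?_
  rw [star_eq_adjoint, ← adjoint_inner_left, ← mul_pow]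
  gcongr
  exact norm_inner_le_norm _ _

lemma eq_zero_of_posTrace_eq_zero {A : H →L[ℂ] H} (hA : 0 ≤ A) (h : posTrace A = 0) : A = 0 := by
  obtain ⟨B, rfl⟩ := CStarAlgebra.nonneg_iff_eq_star_mul_self.mp hA
  suffices B = 0 by simp [this]
  ext x
  have := ofReal_norm_sq_apply_le B x
  rw [h, zero_mul, nonpos_iff_eq_zero, ENNReal.ofReal_eq_zero] at this
  have : ‖B x‖ = 0 := by nlinarith [norm_nonneg (B x)]
  simpa using this

lemma nonneg_of_re_inner_nonneg {A : H →L[ℂ] H} (hA : IsSelfAdjoint A)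
    (h : ∀ x, 0 ≤ (⟪x, A x⟫_ℂ).re) : 0 ≤ A := by
  rw [nonneg_iff_isPositive, isPositive_def']
  refine ⟨hA, fun x => ?_⟩
  rw [reApplyInnerSelf_apply, inner_re_symm]
  exact h x

lemma posTrace_add {A B : H →L[ℂ] H} (hA : 0 ≤ A) (hB : 0 ≤ B) :
    posTrace (A + B) = posTrace A + posTrace B := by
  unfold posTrace
  rw [← ENNReal.tsum_add]
  congr 1; funext i
  rw [add_apply, inner_add_right, Complex.add_re,
    ENNReal.ofReal_add (re_inner_nonneg hA _) (re_inner_nonneg hB _)]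

lemma posTrace_rankOne_self (x : H) :
    posTrace (rankOne ℂ x x) = ENNReal.ofReal (‖x‖ ^ 2) := by
  rw [ofReal_norm_sq_eq_tsum]
  unfold posTrace
  congr 1; funext i
  rw [rankOne_apply, inner_smul_right, ← inner_conj_symm x, ← Complex.normSq_eq_conj_mul_self,
    Complex.ofReal_re, Complex.normSq_eq_norm_sq]

lemma isDensityOperator_rankOne {x : H} (hx : ‖x‖ = 1) : IsDensityOperator (rankOne ℂ x x) :=
  ⟨rankOne_self_nonneg x, by simp [posTrace_rankOne_self, hx]⟩

/-- A positive operator is at most its trace times the identity. -/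
lemma IsDensityOperator.le_one {A : H →L[ℂ] H} (hA : IsDensityOperator A) : A ≤ 1 := by
  rw [← sub_nonneg]
  refine nonneg_of_re_inner_nonneg ((IsSelfAdjoint.one _).sub (.of_nonneg hA.1)) fun x => ?_
  obtain ⟨B, hB⟩ := CStarAlgebra.nonneg_iff_eq_star_mul_self.mp hA.1
  have h := ofReal_norm_sq_apply_le B x
  rw [← hB, hA.2, one_mul, ENNReal.ofReal_le_ofReal_iff (by positivity)] at h
  have h1 : ⟪x, A x⟫_ℂ = ((‖B x‖ ^ 2 : ℝ) : ℂ) := by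
    rw [hB, mul_def, comp_apply, star_eq_adjoint, adjoint_inner_right, inner_self_eq_norm_sq_to_K]
    norm_cast
  have h2 : ⟪x, x⟫_ℂ = ((‖x‖ ^ 2 : ℝ) : ℂ) := by
    rw [inner_self_eq_norm_sq_to_K]; norm_cast
  rw [sub_apply, one_def, id_apply, inner_sub_right, h1, h2, Complex.sub_re, Complex.ofReal_re,
    Complex.ofReal_re]
  linarith

lemma IsDensityOperator.mem_Icc_of_mem_spectrum {A : H →L[ℂ] H} (hA : IsDensityOperator A)
    {t : ℝ} (ht : t ∈ spectrum ℝ A) : t ∈ Set.Icc (0 : ℝ) 1 := by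
  have h1 := hA.le_one
  rw [← map_one (algebraMap ℝ (H →L[ℂ] H)),
    le_algebraMap_iff_spectrum_le (ha := IsSelfAdjoint.of_nonneg hA.1)] at h1
  exact ⟨spectrum_nonneg_of_nonneg hA.1 ht, h1 t ht⟩

end Trace

/-! ### States of entropy zero -/

section Entropy

variable {H : Type*} [NormedAddCommGroup H] [InnerProductSpace ℂ H] [CompleteSpace H]

lemma continuous_neg_mul_logb : Continuous fun x : ℝ => -(x * Real.logb 2 x) := by
  simp only [Real.logb, ← mul_div_assoc]
  exact (Real.continuous_mul_log.div_const _).neg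

lemma IsDensityOperator.cfc_nonneg {A : H →L[ℂ] H} (hA : IsDensityOperator A) :
    0 ≤ cfc (fun x : ℝ => -(x * Real.logb 2 x)) A := by
  refine _root_.cfc_nonneg fun t ht => ?_
  obtain ⟨h0, h1⟩ := hA.mem_Icc_of_mem_spectrum ht
  have := Real.logb_nonpos (b := 2) (by norm_num) h0 h1
  nlinarith

/-- The function `- x log₂ x` vanishes on `[0, 1]` exactly at `0` and `1`, so the entropy of a state
is zero exactly if its spectrum lies in `{0, 1}`. -/
lemma IsDensityOperator.entropy_eq_zero_iff_isIdempotentElem {A : H →L[ℂ] H} (hA : IsDensityOperator A) :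
    entropy A = 0 ↔ IsIdempotentElem A := by
  have hsa : IsSelfAdjoint A := .of_nonneg hA.1
  have hf (t : ℝ) (ht : t ∈ spectrum ℝ A) : -(t * Real.logb 2 t) = 0 ↔ t ∈ ({0, 1} : Set ℝ) := by
    have h0 := (hA.mem_Icc_of_mem_spectrum ht).1
    simp only [neg_eq_zero, mul_eq_zero, Real.logb_eq_zero, Set.mem_insert_iff,
      Set.mem_singleton_iff]
    constructor
    · rintro (h | h | h | h | h | h | h) <;> first | (exfalso; linarith) | simp [h]
    · rintro (h | h) <;> simp [h]
  rw [isIdempotentElem_iff_spectrum_subset ℝ A hsa]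
  have key : entropy A = 0 ↔
      cfc (fun x : ℝ => -(x * Real.logb 2 x)) A = cfc (fun _ => (0 : ℝ)) A := by
    rw [cfc_const_zero]
    refine ⟨eq_zero_of_posTrace_eq_zero hA.cfc_nonneg, fun h => ?_⟩
    rw [entropy, h]
    simp [posTrace]
  rw [key, cfc_eq_cfc_iff_eqOn (ha := hsa) (hf := continuous_neg_mul_logb.continuousOn)]
  exact ⟨fun h t ht => (hf t ht).mp (h ht), fun h t ht => (hf t ht).mpr (h ht)⟩

/-- A projection of trace one has rank one. -/
lemma IsDensityOperator.exists_eq_rankOne {A : H →L[ℂ] H} (hA : IsDensityOperator A)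
    (hi : IsIdempotentElem A) : ∃ f : H, ‖f‖ = 1 ∧ A = rankOne ℂ f f := by
  have hsa : IsSelfAdjoint A := .of_nonneg hA.1
  have hne : A ≠ 0 := by
    rintro rfl
    simpa [posTrace] using hA.2
  obtain ⟨y, hy⟩ : ∃ y, A y ≠ 0 := by
    by_contra! h
    exact hne (ContinuousLinearMap.ext h)
  have hAA (x : H) : A (A x) = A x := by
    rw [← comp_apply, ← mul_def, hi.eq]
  set f : H := ((‖A y‖⁻¹ : ℝ) : ℂ) • A y with hf
  have hf1 : ‖f‖ = 1 := by
    rw [hf, norm_smul, Complex.norm_real, norm_inv, norm_norm,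
      inv_mul_cancel₀ (norm_ne_zero_iff.mpr hy)]
  have hAf : A f = f := by rw [hf, map_smul, hAA]
  refine ⟨f, hf1, ?_⟩
  have hsymm (x z : H) : ⟪A x, z⟫_ℂ = ⟪x, A z⟫_ℂ := hsa.isSymmetric x z
  -- `A - |f⟩⟨f|` is positive of trace `1 - 1 = 0`, hence zero.
  have hpos : 0 ≤ A - rankOne ℂ f f := by
    refine nonneg_of_re_inner_nonneg (hsa.sub (.of_nonneg (rankOne_self_nonneg f))) fun x => ?_
    have h1 : ⟪x, A x⟫_ℂ = ((‖A x‖ ^ 2 : ℝ) : ℂ) := by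
      rw [← hAA, ← hsymm, inner_self_eq_norm_sq_to_K, hAA]
      norm_cast
    have h2 : ⟪x, rankOne ℂ f f x⟫_ℂ = ((‖⟪f, A x⟫_ℂ‖ ^ 2 : ℝ) : ℂ) := by
      rw [rankOne_apply, inner_smul_right, ← inner_conj_symm x, Complex.mul_conj,
        Complex.normSq_eq_norm_sq, ← hsymm, hAf]
    rw [sub_apply, inner_sub_right, h1, h2, Complex.sub_re, Complex.ofReal_re, Complex.ofReal_re,
      sub_nonneg]
    gcongr
    simpa [hf1] using norm_inner_le_norm (𝕜 := ℂ) f (A x)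
  have htr := posTrace_add hpos (rankOne_self_nonneg f)
  rw [sub_add_cancel, hA.2, (isDensityOperator_rankOne hf1).2] at htr
  refine sub_eq_zero.mp (eq_zero_of_posTrace_eq_zero hpos ?_)
  rw [← ENNReal.add_left_inj ENNReal.one_ne_top, ← htr, zero_add]

/-- The two notions of trace agree on positive operators. If the trace is infinite, both sides take
the junk value `0`. -/
lemma trace_eq_toReal_posTrace {A : H →L[ℂ] H} (hA : 0 ≤ A) :
    trace A = ((posTrace A).toReal : ℂ) := by
  have hre (i) : ⟪basis H i, A (basis H i)⟫_ℂ = ((⟪basis H i, A (basis H i)⟫_ℂ).re : ℂ) := by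
    have := ((nonneg_iff_isPositive A).mp hA).inner_nonneg_right (basis H i)
    exact Complex.ext rfl (Complex.nonneg_iff.mp this).2.symm
  unfold trace posTrace
  rw [ENNReal.tsum_toReal_eq fun i => ENNReal.ofReal_ne_top]
  simp_rw [ENNReal.toReal_ofReal (re_inner_nonneg hA _)]
  rw [Complex.ofReal_tsum]
  exact tsum_congr hre

lemma IsDensityOperator.map {Φ : (H →L[ℂ] H) →CP (H →L[ℂ] H)} (hΦ : IsQuantumChannel Φ)
    {A : H →L[ℂ] H} (hA : IsDensityOperator A) : IsDensityOperator (Φ A) := by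
  have hpos : 0 ≤ Φ A := map_nonneg Φ hA.1
  have hA' : IsTraceClass A := by
    rw [IsTraceClass, CFC.abs_of_nonneg A hA.1, hA.2]
    exact ENNReal.one_lt_top
  obtain ⟨h1, h2⟩ := hΦ.tracePreserving A hA'
  rw [IsTraceClass, CFC.abs_of_nonneg _ hpos] at h1
  rw [trace_eq_toReal_posTrace hpos, trace_eq_toReal_posTrace hA.1, hA.2] at h2
  refine ⟨hpos, ?_⟩
  rw [← ENNReal.toReal_eq_one_iff]
  exact_mod_cast h2

end Entropy

/-! ### Conjugation by an isometry -/

section Conjugation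

variable {H : Type*} [NormedAddCommGroup H] [InnerProductSpace ℂ H] [CompleteSpace H]

/-- With `A = B* B` and `C = B V*`, this is `tr (C* C) = tr (C C*)`. -/
lemma posTrace_conj {V : H →L[ℂ] H} (hV : star V * V = 1) {A : H →L[ℂ] H} (hA : 0 ≤ A) :
    posTrace (V * A * star V) = posTrace A := by
  obtain ⟨B, rfl⟩ := CStarAlgebra.nonneg_iff_eq_star_mul_self.mp hA
  have h := posTrace_star_mul_self_comm (B * star V)
  simp only [star_mul, star_star] at h
  rw [← mul_assoc, mul_assoc, h, posTrace_star_mul_self_comm, mul_assoc, ← mul_assoc (star V), hV,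
    one_mul]

/-- Conjugation by an isometry, a non-unital star homomorphism of `B(H)`. -/
def isometryConj (V : H →L[ℂ] H) (hV : star V * V = 1) : (H →L[ℂ] H) →⋆ₙₐ[ℂ] (H →L[ℂ] H) where
  toFun X := V * X * star V
  map_smul' c X := by simp
  map_zero' := by simp
  map_add' X Y := by rw [mul_add, add_mul]
  map_mul' X Y := by
    calc V * (X * Y) * star V = V * X * 1 * Y * star V := by simp only [mul_one, mul_assoc]
      _ = _ := by rw [← hV]; simp only [mul_assoc]
  map_star' X := by simp [mul_assoc]

lemma entropy_conj {V : H →L[ℂ] H} (hV : star V * V = 1) {A : H →L[ℂ] H}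
    (hA : IsDensityOperator A) : entropy (V * A * star V) = entropy A := by
  have hsa : IsSelfAdjoint A := .of_nonneg hA.1
  have hsa' : IsSelfAdjoint (isometryConj V hV A) := hsa.map _
  have hc : Continuous (isometryConj V hV) := by
    change Continuous fun X => V * X * star V
    fun_prop
  have h := NonUnitalStarAlgHomClass.map_cfcₙ (isometryConj V hV)
    (fun x : ℝ => -(x * Real.logb 2 x)) A continuous_neg_mul_logb.continuousOn (by simp) hc hsa hsa'
  rw [cfcₙ_eq_cfc continuous_neg_mul_logb.continuousOn (by simp),
    cfcₙ_eq_cfc continuous_neg_mul_logb.continuousOn (by simp)] at h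
  calc entropy (V * A * star V)
      = posTrace (V * cfc (fun x : ℝ => -(x * Real.logb 2 x)) A * star V) :=
        congrArg posTrace h.symm
    _ = entropy A := posTrace_conj hV hA.cfc_nonneg

end Conjugation

/-! ### Complete positivity and Gram matrices -/

section Gram

variable {H : Type*} [NormedAddCommGroup H] [InnerProductSpace ℂ H] [CompleteSpace H]

lemma exists_eq_star_mul_self_of_nonneg {A : Type*} [NonUnitalCStarAlgebra A] [PartialOrder A]
    [StarOrderedRing A] {a : A} (ha : 0 ≤ a) : ∃ b, a = star b * b :=
  CStarAlgebra.nonneg_iff_eq_star_mul_self.mp ha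

/-- A finite form of the Stinespring dilation: the kernel `⟪hᵢ, Φ(Tᵢ* Tⱼ) hⱼ⟫` is the Gram matrix of
vectors in a Hilbert space. The matrix `(Tᵢ* Tⱼ)` is `N* N`, where `N` has first row `(Tⱼ)` and other
rows zero, so its image under `Φ` is of the form `R* R`. -/
lemma exists_gram (Φ : (H →L[ℂ] H) →CP (H →L[ℂ] H)) {k : ℕ} (T : Fin (k + 1) → (H →L[ℂ] H))
    (h : Fin (k + 1) → H) : ∃ u : Fin (k + 1) → PiLp 2 (fun _ : Fin (k + 1) => H),
      ∀ i j, ⟪u i, u j⟫_ℂ = ⟪h i, Φ (star (T i) * T j) (h j)⟫_ℂ := by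
  let N : CStarMatrix (Fin (k + 1)) (Fin (k + 1)) (H →L[ℂ] H) :=
    CStarMatrix.ofMatrix fun l j => if l = 0 then T j else 0
  have hNe (l j) : N l j = if l = 0 then T j else 0 := rfl
  have hN (i j) : (star N * N) i j = star (T i) * T j := by
    rw [CStarMatrix.mul_apply, Finset.sum_eq_single 0]
    · simp [hNe, CStarMatrix.star_apply]
    · intro l _ hl
      simp [hNe, CStarMatrix.star_apply, hl]
    · simp
  obtain ⟨R, hR⟩ := exists_eq_star_mul_self_of_nonneg
    (Φ.map_cstarMatrix_nonneg (star N * N) (star_mul_self_nonneg N))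
  refine ⟨fun i => WithLp.toLp 2 fun l => R l i (h i), fun i j => ?_⟩
  have hij : Φ (star (T i) * T j) = ∑ l, star (R l i) * R l j := by
    rw [← hN, ← CStarMatrix.map_apply (f := Φ), hR, CStarMatrix.mul_apply]
    simp [CStarMatrix.star_apply]
  rw [PiLp.inner_apply, hij, sum_apply, inner_sum]
  refine Finset.sum_congr rfl fun l _ => ?_
  rw [mul_def, comp_apply, star_eq_adjoint, adjoint_inner_right]

/-- The operators `|xᵢ⟩⟨xⱼ|` are of the form `Tᵢ* Tⱼ`, with `Tᵢ = |g⟩⟨xᵢ|` for a fixed unit vector `g`. -/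
lemma exists_gram_rankOne [Nontrivial H] (Φ : (H →L[ℂ] H) →CP (H →L[ℂ] H)) {k : ℕ}
    (x h : Fin (k + 1) → H) : ∃ u : Fin (k + 1) → PiLp 2 (fun _ : Fin (k + 1) => H),
      ∀ i j, ⟪u i, u j⟫_ℂ = ⟪h i, Φ (rankOne ℂ (x i) (x j)) (h j)⟫_ℂ := by
  obtain ⟨g, hg⟩ := exists_norm_eq H (zero_le_one (α := ℝ))
  obtain ⟨u, hu⟩ := exists_gram Φ (fun i => rankOne ℂ g (x i)) h
  refine ⟨u, fun i j => ?_⟩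
  rw [hu, star_eq_adjoint, adjoint_rankOne, mul_def, rankOne_comp_rankOne,
    inner_self_eq_norm_sq_to_K, hg]
  simp

lemma inner_map_rankOne_swap [Nontrivial H] (Φ : (H →L[ℂ] H) →CP (H →L[ℂ] H)) (x y h h' : H) :
    ⟪h', Φ (rankOne ℂ y x) h⟫_ℂ = starRingEnd ℂ ⟪h, Φ (rankOne ℂ x y) h'⟫_ℂ := by
  obtain ⟨u, hu⟩ := exists_gram_rankOne Φ ![x, y] ![h, h']
  have h1 := hu 0 1
  have h2 := hu 1 0
  simp only [Matrix.cons_val_zero, Matrix.cons_val_one] at h1 h2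
  rw [← h1, ← h2, inner_conj_symm]

/-- The Gram vector of `(x, h)` has norm `|⟪f, h⟫| = 0`. -/
lemma inner_map_rankOne_eq_zero [Nontrivial H] (Φ : (H →L[ℂ] H) →CP (H →L[ℂ] H)) {x f : H}
    (hx : Φ (rankOne ℂ x x) = rankOne ℂ f f) (y : H) {h : H} (hfh : ⟪f, h⟫_ℂ = 0) (h' : H) :
    ⟪h, Φ (rankOne ℂ x y) h'⟫_ℂ = 0 := by
  obtain ⟨u, hu⟩ := exists_gram_rankOne Φ ![x, y] ![h, h']
  have h1 := hu 0 1
  have h2 := hu 0 0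
  simp only [Matrix.cons_val_zero, Matrix.cons_val_one] at h1 h2
  rw [hx, rankOne_apply, hfh, zero_smul, inner_zero_right, inner_self_eq_zero] at h2
  rw [← h1, h2, inner_zero_left]

/-- If `Φ` maps `|x⟩⟨x|` to `|f⟩⟨f|` and `|y⟩⟨y|` to `|g⟩⟨g|`, then it maps `|x⟩⟨y|` to a multiple of
`|f⟩⟨g|`. -/
lemma map_rankOne_eq_smul [Nontrivial H] (Φ : (H →L[ℂ] H) →CP (H →L[ℂ] H)) {x y f g : H}
    (hf : ‖f‖ = 1) (hg : ‖g‖ = 1)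
    (hx : Φ (rankOne ℂ x x) = rankOne ℂ f f) (hy : Φ (rankOne ℂ y y) = rankOne ℂ g g) :
    Φ (rankOne ℂ x y) = ⟪f, Φ (rankOne ℂ x y) g⟫_ℂ • rankOne ℂ f g := by
  have hff : ⟪f, f⟫_ℂ = 1 := by simp [inner_self_eq_norm_sq_to_K, hf]
  have hgg : ⟪g, g⟫_ℂ = 1 := by simp [inner_self_eq_norm_sq_to_K, hg]
  refine ContinuousLinearMap.ext fun h' => ext_inner_left ℂ fun h => ?_
  have h1 := inner_map_rankOne_eq_zero Φ hx y (h := h - ⟪f, h⟫_ℂ • f)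
    (by rw [inner_sub_right, inner_smul_right, hff, mul_one, sub_self]) h'
  have h2 := inner_map_rankOne_eq_zero Φ hy x (h := h' - ⟪g, h'⟫_ℂ • g)
    (by rw [inner_sub_right, inner_smul_right, hgg, mul_one, sub_self]) f
  rw [inner_map_rankOne_swap, map_eq_zero, map_sub, inner_sub_right, map_smul, inner_smul_right,
    sub_eq_zero] at h2
  rw [inner_sub_left, inner_smul_left, inner_conj_symm, sub_eq_zero, h2] at h1
  rw [h1, smul_apply, rankOne_apply, inner_smul_right, inner_smul_right]
  ring

end Gram

/-! ### Entropy-preserving channels on rank-one operators -/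

section RankOne

variable {H : Type*} [NormedAddCommGroup H] [InnerProductSpace ℂ H] [CompleteSpace H]

lemma isTraceClass_rankOne (x : H) {y : H} (hx : ‖x‖ = 1) (hy : ‖y‖ = 1) :
    IsTraceClass (rankOne ℂ x y) := by
  have h : CFC.abs (rankOne ℂ x y) = rankOne ℂ y y := by
    rw [CFC.abs]
    refine CFC.sqrt_unique ?_ (rankOne_self_nonneg y)
    rw [star_eq_adjoint, adjoint_rankOne, mul_def, mul_def, rankOne_comp_rankOne,
      rankOne_comp_rankOne, inner_self_eq_norm_sq_to_K, inner_self_eq_norm_sq_to_K, hx, hy]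
  rw [IsTraceClass, h, posTrace_rankOne_self]
  exact ENNReal.ofReal_lt_top

lemma trace_rankOne (x y : H) : trace (rankOne ℂ x y) = ⟪y, x⟫_ℂ := by
  rw [trace, ← (basis H).tsum_inner_mul_inner]
  simp only [rankOne_apply, inner_smul_right]

lemma trace_smul (c : ℂ) (A : H →L[ℂ] H) : trace (c • A) = c * trace A := by
  simp only [trace, smul_apply, inner_smul_right, tsum_mul_left]

variable {Φ : (H →L[ℂ] H) →CP (H →L[ℂ] H)}

/-- An entropy-preserving channel maps pure states to pure states. -/
lemma IsQuantumChannel.exists_map_rankOne_eq (hΦ : IsQuantumChannel Φ)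
    (hS : ∀ ρ : H →L[ℂ] H, IsDensityOperator ρ → entropy (Φ ρ) = entropy ρ) {x : H}
    (hx : ‖x‖ = 1) : ∃ f : H, ‖f‖ = 1 ∧ Φ (rankOne ℂ x x) = rankOne ℂ f f := by
  have hd := isDensityOperator_rankOne hx
  refine (hd.map hΦ).exists_eq_rankOne ?_
  rw [← (hd.map hΦ).entropy_eq_zero_iff_isIdempotentElem, hS _ hd,
    hd.entropy_eq_zero_iff_isIdempotentElem]
  exact isIdempotentElem_rankOne_self hx

lemma sqrt_half_mul_self : ((Real.sqrt (1 / 2) : ℝ) : ℂ) * (Real.sqrt (1 / 2) : ℝ) = 1 / 2 := by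
  rw [← Complex.ofReal_mul, Real.mul_self_sqrt (by norm_num)]
  norm_num

lemma isDensityOperator_half_smul {x y : H} (hx : ‖x‖ = 1) (hy : ‖y‖ = 1) :
    IsDensityOperator ((1 / 2 : ℂ) • (rankOne ℂ x x + rankOne ℂ y y)) := by
  have hn : ‖((Real.sqrt (1 / 2) : ℝ) : ℂ)‖ ^ 2 = 1 / 2 := by
    rw [Complex.norm_real, Real.norm_eq_abs, sq_abs, Real.sq_sqrt (by norm_num)]
  have h (z : H) : (1 / 2 : ℂ) • rankOne ℂ z z =
      rankOne ℂ (((Real.sqrt (1 / 2) : ℝ) : ℂ) • z) (((Real.sqrt (1 / 2) : ℝ) : ℂ) • z) := by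
    ext w
    simp only [smul_apply, rankOne_apply, inner_smul_left, smul_smul, Complex.conj_ofReal]
    rw [← sqrt_half_mul_self]
    congr 1; ring
  rw [smul_add, h, h]
  refine ⟨add_nonneg (rankOne_self_nonneg _) (rankOne_self_nonneg _), ?_⟩
  rw [posTrace_add (rankOne_self_nonneg _) (rankOne_self_nonneg _), posTrace_rankOne_self,
    posTrace_rankOne_self, norm_smul, norm_smul, mul_pow, mul_pow, hn, hx, hy,
    ← ENNReal.ofReal_add (by norm_num) (by norm_num)]
  norm_num

/-- An entropy-preserving channel maps orthogonal pure states to orthogonal pure states, and keeps the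
modulus of the coherence between them. -/
lemma IsQuantumChannel.map_rankOne_of_orthogonal [Nontrivial H] (hΦ : IsQuantumChannel Φ)
    (hS : ∀ ρ : H →L[ℂ] H, IsDensityOperator ρ → entropy (Φ ρ) = entropy ρ) {x y f g : H}
    (hx : ‖x‖ = 1) (hy : ‖y‖ = 1) (hxy : ⟪x, y⟫_ℂ = 0) (hf : ‖f‖ = 1) (hg : ‖g‖ = 1)
    (hxf : Φ (rankOne ℂ x x) = rankOne ℂ f f) (hyg : Φ (rankOne ℂ y y) = rankOne ℂ g g) :
    ⟪f, g⟫_ℂ = 0 ∧ ∃ c : ℂ, ‖c‖ = 1 ∧ Φ (rankOne ℂ x y) = c • rankOne ℂ f g := by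
  have hff : ⟪f, f⟫_ℂ = 1 := by simp [inner_self_eq_norm_sq_to_K, hf]
  have hgg : ⟪g, g⟫_ℂ = 1 := by simp [inner_self_eq_norm_sq_to_K, hg]
  have hxx : ⟪x, x⟫_ℂ = 1 := by simp [inner_self_eq_norm_sq_to_K, hx]
  have hyx : ⟪y, x⟫_ℂ = 0 := by rw [← inner_conj_symm, hxy, map_zero]
  have h1 := map_rankOne_eq_smul Φ hf hg hxf hyg
  have h2 := map_rankOne_eq_smul Φ hg hf hyg hxf
  rw [inner_map_rankOne_swap Φ x y f g] at h2
  set c := ⟪f, Φ (rankOne ℂ x y) g⟫_ℂ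
  set ψ : H := ((Real.sqrt (1 / 2) : ℝ) : ℂ) • (x + y) with hψ
  have hψn : ‖ψ‖ = 1 := by
    have h : ‖x + y‖ ^ 2 = 2 := by
      rw [pow_two, norm_add_sq_eq_norm_sq_add_norm_sq_of_inner_eq_zero x y hxy, hx, hy]
      norm_num
    rw [hψ, norm_smul, Complex.norm_real, Real.norm_of_nonneg (Real.sqrt_nonneg _),
      ← Real.sqrt_sq (norm_nonneg (x + y)), h, ← Real.sqrt_mul (by norm_num)]
    norm_num
  have hψψ : rankOne ℂ ψ ψ = (1 / 2 : ℂ) •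
      ((rankOne ℂ x x + rankOne ℂ y y) + (rankOne ℂ x y + rankOne ℂ y x)) := by
    ext w
    simp only [hψ, rankOne_apply, smul_apply, add_apply, inner_smul_left, inner_add_left,
      Complex.conj_ofReal, smul_smul]
    rw [← sqrt_half_mul_self]
    module
  obtain ⟨k, hk, hψk⟩ := hΦ.exists_map_rankOne_eq hS hψn
  have hidem : IsIdempotentElem (Φ (rankOne ℂ ψ ψ)) := by
    rw [hψk]; exact isIdempotentElem_rankOne_self hk
  rw [hψψ] at hidem
  have hc : c ≠ 0 := by
    intro hc
    -- Without the off-diagonal terms, the image of `|ψ⟩⟨ψ|` is also the image of the mixture of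
    -- `|x⟩⟨x|` and `|y⟩⟨y|`, which has positive entropy.
    rw [hc, zero_smul] at h1
    rw [hc, map_zero, zero_smul] at h2
    rw [map_smul, map_add, map_add Φ (rankOne ℂ x y), h1, h2, add_zero, add_zero,
      ← map_smul] at hidem
    have hd := isDensityOperator_half_smul hx hy
    rw [← (hd.map hΦ).entropy_eq_zero_iff_isIdempotentElem, hS _ hd,
      hd.entropy_eq_zero_iff_isIdempotentElem] at hidem
    have := congrArg (fun A : H →L[ℂ] H => ⟪x, A x⟫_ℂ) hidem.eq
    simp only [mul_def, comp_apply, smul_apply, add_apply, rankOne_apply, map_smul, hxx, hyx,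
      one_smul, zero_smul, add_zero, inner_smul_right] at this
    norm_num at this
  have hfg : ⟪f, g⟫_ℂ = 0 := by
    -- `tr |x⟩⟨y| = ⟪y, x⟫ = 0`, while the image has trace `c ⟪g, f⟫`.
    have ht := (hΦ.tracePreserving _ (isTraceClass_rankOne x hx hy)).2
    rw [h1, trace_smul, trace_rankOne, trace_rankOne, hyx, mul_eq_zero] at ht
    rw [← inner_conj_symm, ht.resolve_left hc, map_zero]
  refine ⟨hfg, c, ?_, h1⟩
  have hgf : ⟪g, f⟫_ℂ = 0 := by rw [← inner_conj_symm, hfg, map_zero]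
  have h3 : Φ ((1 / 2 : ℂ) •
      ((rankOne ℂ x x + rankOne ℂ y y) + (rankOne ℂ x y + rankOne ℂ y x))) =
      (1 / 2 : ℂ) • ((rankOne ℂ f f + rankOne ℂ g g) +
        (c • rankOne ℂ f g + starRingEnd ℂ c • rankOne ℂ g f)) := by
    simp only [map_smul, map_add, hxf, hyg]
    rw [h1, h2]
  rw [h3] at hidem
  -- With `σ` the image of `|ψ⟩⟨ψ|`, `⟪f, σ² f⟫ = (1 + |c|²) / 4` and `⟪f, σ f⟫ = 1 / 2`.
  have := congrArg (fun A : H →L[ℂ] H => ⟪f, A f⟫_ℂ) hidem.eq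
  simp only [mul_def, comp_apply, smul_apply, add_apply, rankOne_apply, map_smul, map_add, hff,
    hgg, hfg, hgf, one_smul, zero_smul, smul_zero, add_zero, zero_add, inner_smul_right,
    inner_add_right, mul_one, mul_zero] at this
  have hcc : c * starRingEnd ℂ c = 1 := by linear_combination 4 * this
  rw [Complex.mul_conj, Complex.normSq_eq_norm_sq] at hcc
  have : ‖c‖ ^ 2 = 1 := by exact_mod_cast hcc
  nlinarith [norm_nonneg c]

end RankOne

/-! ### Normal maps and finite compressions -/

section Normal

variable {H : Type*} [NormedAddCommGroup H] [InnerProductSpace ℂ H]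

/-- The matrix elements of a normal map are ultraweakly continuous functionals: the functional
`T ↦ ⟪y, T x⟫` is given by the sequences `(x, 0, 0, …)` and `(y, 0, 0, …)`. -/
lemma IsNormalMap.tendsto_inner {Φ : (H →L[ℂ] H) → (H →L[ℂ] H)} (hΦ : IsNormalMap Φ)
    {ι : Type*} {l : Filter ι} {T : ι → (H →L[ℂ] H)} {T₀ : H →L[ℂ] H}
    (hT : Tendsto T l (@nhds _ (ultraweakTopology H) T₀)) (x y : H) :
    Tendsto (fun i => ⟪y, Φ (T i) x⟫_ℂ) l (𝓝 ⟪y, Φ T₀ x⟫_ℂ) := by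
  let x' : ℕ → H := fun n => if n = 0 then x else 0
  let y' : ℕ → H := fun n => if n = 0 then y else 0
  have hx' : Summable fun n => ‖x' n‖ ^ 2 :=
    summable_of_ne_finset_zero (s := {0}) fun n hn => by
      simp [x', show n ≠ 0 by simpa using hn]
  have hy' : Summable fun n => ‖y' n‖ ^ 2 :=
    summable_of_ne_finset_zero (s := {0}) fun n hn => by
      simp [y', show n ≠ 0 by simpa using hn]
  have hsum (A : H →L[ℂ] H) : ∑' n, ⟪y' n, A (x' n)⟫_ℂ = ⟪y, A x⟫_ℂ := by
    rw [tsum_eq_single 0 fun n hn => by simp [x', hn]]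
    simp [x', y']
  have hc : @Continuous _ _ (ultraweakTopology H) _ fun A : H →L[ℂ] H => ⟪y, A x⟫_ℂ := by
    simp_rw [← hsum]
    exact continuous_iff_le_induced.mpr
      (iInf_le_of_le x' (iInf_le_of_le y' (iInf_le_of_le hx' (iInf_le _ hy'))))
  have hc' : @Continuous _ _ (ultraweakTopology H) _ fun A : H →L[ℂ] H => ⟪y, Φ A x⟫_ℂ :=
    @Continuous.comp _ _ _ (ultraweakTopology H) (ultraweakTopology H) _ _ _ hc hΦ
  exact ((@Continuous.tendsto _ _ (ultraweakTopology H) _ _ hc' T₀).comp hT)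

/-- A norm-bounded family converging weakly converges ultraweakly. -/
lemma tendsto_ultraweak_of_bounded {ι : Type*} {l : Filter ι} {T : ι → (H →L[ℂ] H)}
    {T₀ : H →L[ℂ] H} {C : ℝ} (hC : ∀ i, ‖T i‖ ≤ C)
    (hT : ∀ x y, Tendsto (fun i => ⟪y, T i x⟫_ℂ) l (𝓝 ⟪y, T₀ x⟫_ℂ)) :
    Tendsto T l (@nhds _ (ultraweakTopology H) T₀) := by
  simp only [nhds_iInf, nhds_induced, tendsto_iInf, tendsto_comap_iff]
  intro x y hx hy
  refine tendsto_tsum_of_dominated_convergence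
    (bound := fun n => C * (‖x n‖ ^ 2 + ‖y n‖ ^ 2)) ((hx.add hy).mul_left C)
    (fun n => hT (x n) (y n)) (Eventually.of_forall fun i n => ?_)
  have hC0 : 0 ≤ C := (norm_nonneg _).trans (hC i)
  calc ‖⟪y n, T i (x n)⟫_ℂ‖ ≤ ‖y n‖ * (C * ‖x n‖) :=
        (norm_inner_le_norm _ _).trans (by gcongr; exact (T i).le_of_opNorm_le (hC i) _)
    _ = C * (‖x n‖ * ‖y n‖) := by ring
    _ ≤ C * (‖x n‖ ^ 2 + ‖y n‖ ^ 2) := by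
        gcongr
        nlinarith [sq_nonneg (‖x n‖ - ‖y n‖), sq_nonneg (‖x n‖), sq_nonneg (‖y n‖)]

variable [CompleteSpace H]

/-- The projection onto the span of finitely many vectors of the basis. -/
def finProj (F : Finset (basisIndex H)) : H →L[ℂ] H :=
  ∑ i ∈ F, rankOne ℂ (basis H i) (basis H i)

lemma finProj_apply (F : Finset (basisIndex H)) (x : H) :
    finProj F x = ∑ i ∈ F, ⟪basis H i, x⟫_ℂ • basis H i := by
  simp [finProj]

lemma norm_finProj_le (F : Finset (basisIndex H)) : ‖finProj F‖ ≤ 1 := by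
  refine opNorm_le_bound _ zero_le_one fun x => ?_
  rw [one_mul, ← sq_le_sq₀ (norm_nonneg _) (norm_nonneg _), finProj_apply]
  have h := (basis H).orthonormal.inner_sum (fun i => ⟪basis H i, x⟫_ℂ)
    (fun i => ⟪basis H i, x⟫_ℂ) F
  rw [inner_self_eq_norm_sq_to_K] at h
  have h2 : ‖∑ i ∈ F, ⟪basis H i, x⟫_ℂ • basis H i‖ ^ 2 = ∑ i ∈ F, ‖⟪basis H i, x⟫_ℂ‖ ^ 2 := by
    have : ((‖∑ i ∈ F, ⟪basis H i, x⟫_ℂ • basis H i‖ ^ 2 : ℝ) : ℂ) =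
        ((∑ i ∈ F, ‖⟪basis H i, x⟫_ℂ‖ ^ 2 : ℝ) : ℂ) := by
      push_cast
      refine h.trans (Finset.sum_congr rfl fun i _ => ?_)
      rw [RCLike.conj_mul]
      norm_cast
    exact_mod_cast this
  rw [h2]
  exact (basis H).orthonormal.sum_inner_products_le x

lemma tendsto_finProj (x : H) :
    Tendsto (fun F : Finset (basisIndex H) => finProj F x) atTop (𝓝 x) := by
  have h := (basis H).hasSum_repr x
  simp only [HilbertBasis.repr_apply_apply] at h
  simp_rw [finProj_apply]
  exact h

lemma inner_finProj (F : Finset (basisIndex H)) (x y : H) :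
    ⟪x, finProj F y⟫_ℂ = ⟪finProj F x, y⟫_ℂ := by
  rw [finProj_apply, finProj_apply, inner_sum, sum_inner]
  refine Finset.sum_congr rfl fun i _ => ?_
  rw [inner_smul_right, inner_smul_left, inner_conj_symm, mul_comm]

lemma tendsto_compression (X : H →L[ℂ] H) (x y : H) :
    Tendsto (fun F : Finset (basisIndex H) => ⟪y, (finProj F * X * finProj F) x⟫_ℂ) atTop
      (𝓝 ⟪y, X x⟫_ℂ) := by
  have h (F : Finset (basisIndex H)) : ⟪y, (finProj F * X * finProj F) x⟫_ℂ =
      ⟪finProj F y, X (finProj F x)⟫_ℂ := by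
    rw [← inner_finProj]
    simp only [mul_def, comp_apply]
  simp_rw [h]
  exact (tendsto_finProj y).inner ((X.continuous.tendsto x).comp (tendsto_finProj x))

lemma compression_eq_sum (F : Finset (basisIndex H)) (X : H →L[ℂ] H) :
    finProj F * X * finProj F = ∑ i ∈ F, ∑ j ∈ F,
      ⟪basis H i, X (basis H j)⟫_ℂ • rankOne ℂ (basis H i) (basis H j) := by
  rw [mul_assoc, finProj, Finset.sum_mul]
  refine Finset.sum_congr rfl fun i _ => ?_
  rw [Finset.mul_sum, Finset.mul_sum]
  refine Finset.sum_congr rfl fun j _ => ?_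
  simp only [mul_def, comp_rankOne, rankOne_apply, map_smul, smul_apply]

/-- A normal linear map that agrees with the conjugation by `V` on matrix units agrees with it
everywhere, because finite compressions converge ultraweakly. -/
lemma IsNormalMap.eq_conj {Φ : (H →L[ℂ] H) →CP (H →L[ℂ] H)} (hΦ : IsNormalMap Φ) {V : H →L[ℂ] H}
    (h : ∀ i j, Φ (rankOne ℂ (basis H i) (basis H j)) =
      rankOne ℂ (V (basis H i)) (V (basis H j))) (X : H →L[ℂ] H) :
    Φ X = V * X * star V := by
  have hF (F : Finset (basisIndex H)) : Φ (finProj F * X * finProj F) =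
      V * (finProj F * X * finProj F) * star V := by
    rw [compression_eq_sum]
    simp only [map_sum, map_smul, h, Finset.mul_sum, Finset.sum_mul]
    refine Finset.sum_congr rfl fun i _ => Finset.sum_congr rfl fun j _ => ?_
    rw [mul_smul_comm, smul_mul_assoc, mul_def, mul_def, comp_rankOne, star_eq_adjoint,
      rankOne_comp, adjoint_adjoint]
  have hlim : Tendsto (fun F : Finset (basisIndex H) => finProj F * X * finProj F) atTop
      (@nhds _ (ultraweakTopology H) X) := by
    refine tendsto_ultraweak_of_bounded (C := 1 * ‖X‖ * 1) (fun F => ?_) (tendsto_compression X)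
    refine (norm_mul_le _ _).trans ?_
    gcongr
    · refine (norm_mul_le _ _).trans ?_
      gcongr
      exact norm_finProj_le F
    · exact norm_finProj_le F
  refine ContinuousLinearMap.ext fun x => ext_inner_left ℂ fun y => ?_
  refine tendsto_nhds_unique (hΦ.tendsto_inner hlim x y) ?_
  simp_rw [hF, mul_def, comp_apply, ← adjoint_inner_left V]
  exact tendsto_compression X (adjoint V x) (adjoint V y)

end Normal

/-! ### The implementing isometry -/

section Isometry

variable {H : Type*} [NormedAddCommGroup H] [InnerProductSpace ℂ H] [CompleteSpace H]

/-- On the matrix units of an orthonormal family, an entropy-preserving channel acts by replacing the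
family with another orthonormal one. -/
lemma IsQuantumChannel.exists_orthonormal [Nontrivial H] {Φ : (H →L[ℂ] H) →CP (H →L[ℂ] H)}
    (hΦ : IsQuantumChannel Φ)
    (hS : ∀ ρ : H →L[ℂ] H, IsDensityOperator ρ → entropy (Φ ρ) = entropy ρ)
    {ι : Type*} {b : ι → H} (hb : Orthonormal ℂ b) :
    ∃ f : ι → H, Orthonormal ℂ f ∧
      ∀ i j, Φ (rankOne ℂ (b i) (b j)) = rankOne ℂ (f i) (f j) := by
  rcases isEmpty_or_nonempty ι with hι | ⟨⟨o⟩⟩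
  · exact ⟨isEmptyElim, ⟨fun i => isEmptyElim i, fun i => isEmptyElim i⟩, fun i => isEmptyElim i⟩
  obtain ⟨e, he, hoe⟩ := hΦ.exists_map_rankOne_eq hS (hb.1 o)
  have hex (i : ι) : ∃ f : H, ‖f‖ = 1 ∧ Φ (rankOne ℂ (b i) (b i)) = rankOne ℂ f f ∧
      Φ (rankOne ℂ (b i) (b o)) = rankOne ℂ f e := by
    rcases eq_or_ne i o with rfl | hio
    · exact ⟨e, he, hoe, hoe⟩
    obtain ⟨g, hg, hig⟩ := hΦ.exists_map_rankOne_eq hS (hb.1 i)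
    obtain ⟨-, c, hc, hcg⟩ :=
      hΦ.map_rankOne_of_orthogonal hS (hb.1 i) (hb.1 o) (hb.2 hio) hg he hig hoe
    have hcc : c * starRingEnd ℂ c = 1 := by
      rw [Complex.mul_conj, Complex.normSq_eq_norm_sq, hc]; norm_num
    refine ⟨c • g, by rw [norm_smul, hc, hg, one_mul], ?_, ?_⟩
    · rw [hig]
      ext w
      simp only [rankOne_apply, inner_smul_left, smul_smul]
      rw [mul_right_comm, mul_comm (starRingEnd ℂ c), hcc, one_mul]
    · rw [hcg]
      ext w
      simp only [smul_apply, rankOne_apply, smul_smul, mul_comm]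
  -- The phases of the `f i` are fixed by `Φ(|bᵢ⟩⟨bₒ|) = |fᵢ⟩⟨e|`.
  choose f hf hff hfo using hex
  refine ⟨f, ⟨hf, fun i j hij => ?_⟩, fun i j => ?_⟩
  · exact (hΦ.map_rankOne_of_orthogonal hS (hb.1 i) (hb.1 j) (hb.2 hij) (hf i) (hf j)
      (hff i) (hff j)).1
  · obtain ⟨u, hu⟩ := exists_gram_rankOne Φ ![b i, b j, b o] ![f i, f j, e]
    have hone {x : H} (hx : ‖x‖ = 1) : ⟪x, x⟫_ℂ = 1 := by simp [inner_self_eq_norm_sq_to_K, hx]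
    have h00 := hu 0 0
    have h11 := hu 1 1
    have h22 := hu 2 2
    have h01 := hu 0 1
    have h02 := hu 0 2
    have h12 := hu 1 2
    simp only [Matrix.cons_val] at h00 h11 h22 h01 h02 h12
    rw [hoe, rankOne_apply, hone he, one_smul, hone he] at h22
    rw [hff, rankOne_apply, hone (hf i), one_smul, hone (hf i)] at h00
    rw [hff, rankOne_apply, hone (hf j), one_smul, hone (hf j)] at h11
    rw [hfo, rankOne_apply, hone he, one_smul, hone (hf i)] at h02
    rw [hfo, rankOne_apply, hone he, one_smul, hone (hf j)] at h12
    have hn {k} (h : ⟪u k, u k⟫_ℂ = 1) : ‖u k‖ = 1 := by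
      rw [norm_eq_sqrt_re_inner (𝕜 := ℂ), h]
      simp
    -- The Gram vectors of `(bᵢ, fᵢ)` and `(bⱼ, fⱼ)` both equal the unit Gram vector of `(bₒ, e)`.
    have e0 := (inner_eq_one_iff_of_norm_eq_one (hn h00) (hn h22)).mp h02
    have e1 := (inner_eq_one_iff_of_norm_eq_one (hn h11) (hn h22)).mp h12
    rw [map_rankOne_eq_smul Φ (hf i) (hf j) (hff i) (hff j), ← h01, e0, e1, h22, one_smul]

lemma exists_isometry_of_orthonormal {f : basisIndex H → H} (hf : Orthonormal ℂ f) :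
    ∃ V : H →L[ℂ] H, star V * V = 1 ∧ ∀ i, V (basis H i) = f i := by
  classical
  let W : H →ₗᵢ[ℂ] H := hf.orthogonalFamily.linearIsometry.comp
    (basis H).repr.toLinearIsometry
  refine ⟨W.toContinuousLinearMap, ?_, fun i => ?_⟩
  · rw [star_eq_adjoint, mul_def, ← norm_map_iff_adjoint_comp_self]
    exact W.norm_map
  · change hf.orthogonalFamily.linearIsometry ((basis H).repr (basis H i)) = f i
    rw [HilbertBasis.repr_self, OrthogonalFamily.linearIsometry_apply_single]
    simp

theorem IsQuantumChannel.exists_isometry {Φ : (H →L[ℂ] H) →CP (H →L[ℂ] H)}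
    (hΦ : IsQuantumChannel Φ)
    (hS : ∀ ρ : H →L[ℂ] H, IsDensityOperator ρ → entropy (Φ ρ) = entropy ρ) :
    ∃ V : H →L[ℂ] H, star V * V = 1 ∧ ∀ X, Φ X = V * X * star V := by
  rcases subsingleton_or_nontrivial H with hH | hH
  · exact ⟨1, Subsingleton.elim _ _, fun X => Subsingleton.elim _ _⟩
  obtain ⟨f, hf, hΦf⟩ := hΦ.exists_orthonormal hS (basis H).orthonormal
  obtain ⟨V, hV, hVf⟩ := exists_isometry_of_orthonormal hf
  exact ⟨V, hV, hΦ.normal.eq_conj fun i j => by rw [hΦf, hVf, hVf]⟩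

end Isometry

end QuantumChannel

end


theorem theorem3p9 {H : Type*} [NormedAddCommGroup H] [InnerProductSpace ℂ H] [CompleteSpace H]
    [TopologicalSpace.SeparableSpace H]
    (Φ : (H →L[ℂ] H) →CP (H →L[ℂ] H)) (hΦ : QuantumChannel.IsQuantumChannel Φ) :
    (∀ ρ : H →L[ℂ] H, QuantumChannel.IsDensityOperator ρ →
        QuantumChannel.entropy (Φ ρ) = QuantumChannel.entropy ρ) ↔
      ∃ V : H →L[ℂ] H, ContinuousLinearMap.adjoint V ∘L V = ContinuousLinearMap.id ℂ H ∧
        ∀ X : H →L[ℂ] H, Φ X = V ∘L X ∘L ContinuousLinearMap.adjoint V := by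
  refine ⟨hΦ.exists_isometry, ?_⟩
  rintro ⟨V, hV, hΦV⟩ ρ hρ
  rw [hΦV]
  exact QuantumChannel.entropy_conj hV hρ
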